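/- Let $n\ge 0$ and $d>1$ be integers and let $\mathfrak p\in\mathbb Z[x_1,\dots,x_n]$ be homogeneous of degree $d$. Let $$\mathcal B(\mathfrak p)=\operatorname{codim}\{z\in\mathbb C^n:\ \partial_{z_1}\mathfrak p(z)=\dots=\partial_{z_n}\mathfrak p(z)=0\}$$ be the Birch rank of $\mathfrak p$, the codimension being that of an algebraic subset of $\mathbb C^n$. Suppose that $\mathcal B(\mathfrak p)>(d-1)2^d$. Then there is a constant $C$, depending only on $\mathfrak p$ (and hence on $n$ and $d$), such that for every integer $q\ge 1$ $$q^{1-n}\,\#\{s\in(\mathbb Z/q\mathbb Z)^n:\ \mathfrak p(s)=0 \text{ in } \mathbb Z/q\mathbb Z\}\le C .$$ -/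

import Mathlib

/-- The codimension in affine space `ℂⁿ` (with its Zariski topology) of an algebraic set `S`:
the height of the ideal of all polynomials vanishing on `S`, that is, the smallest of the
codimensions (lengths of maximal chains of primes below) of the irreducible components of `S`.
It is `⊤` for the empty set. -/
noncomputable def affineCodim {n : ℕ} (S : Set (Fin n → ℂ)) : ℕ∞ :=
  (MvPolynomial.vanishingIdeal ℂ S).height

/-- The complex singular locus `{z ∈ ℂⁿ : ∂𝔭/∂z₁(z) = ⋯ = ∂𝔭/∂zₙ(z) = 0}` of an integral
polynomial `𝔭`. -/
def singularLocus {n : ℕ} (p : MvPolynomial (Fin n) ℤ) : Set (Fin n → ℂ) :=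
  {z | ∀ i : Fin n, MvPolynomial.aeval z (MvPolynomial.pderiv i p) = 0}

/-- The Birch rank `𝓑(𝔭)`: the codimension in `ℂⁿ` of the complex singular locus of `𝔭`. -/
noncomputable def birchRank {n : ℕ} (p : MvPolynomial (Fin n) ℤ) : ℕ∞ :=
  affineCodim (singularLocus p)

/-- The number of solutions of `𝔭(s) ≡ 0 (mod q)` with `s ∈ (ℤ/qℤ)ⁿ`
(a finite set for `q ≥ 1`). -/
noncomputable def solutionCount {n : ℕ} (p : MvPolynomial (Fin n) ℤ) (q : ℕ) : ℕ :=
  {s : Fin n → ZMod q | MvPolynomial.aeval s p = 0}.ncard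

/-!
The number of solutions of `p ≡ 0` modulo `q` is `q⁻¹ ∑ S(a)`, the sum running over all residue
classes `a` modulo `q`, where `S(a)` is the complete exponential sum of `a p`. Write `d = m + 1`,
`L = 2 ^ m * m`, and let `r` be the order of `a` in `ℤ/qℤ`. Birch's method gives
`|S(a)| ≪ q ^ n * r ^ (-B / L)` whenever `B` is an integer not exceeding the Birch rank. The
hypothesis allows `B = 2 L + 1`. Since at most `r` classes have order `r`, the number of solutions
is then `≪ q ^ (n - 1) * ∑ r ^ (-1 - 1 / L)`, and the series converges.

The bound for `S(a)` holds for all moduli at once, without passing to prime powers: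

* Weyl differencing `m` times on the finite group `(ℤ/qℤ)ⁿ` (`weyl_inequality`) bounds `S(a)` by the
  number of `h = (h₁, …, hₘ)` modulo `q` with `a Φᵢ(h) ≡ 0` for all `i`, where `Φᵢ` is the
  multilinear form attached to `∂ᵢ p` (`polar`, with integral coefficients `polarCoeff`).
* Since these conditions are linear in each `hₗ`, the pigeonhole principle, applied to one `hₗ` at a
  time, shrinks the box of side `q` to a box of side `T` at the cost of a factor
  `(2 q / T) ^ (m * n)` (`ncard_le_card_pow_mul`). If `T ^ m` is a small multiple of `r`, the
  congruences `Φᵢ(h) ≡ 0` modulo `r` have become equations over `ℤ`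
  (`exists_ncard_congruence_pow_le`).
* The integral zeros of the `Φᵢ` of size `T` number `≪ T ^ (m * n - B)`
  (`exists_card_polar_zeros_le`). Indeed `Φᵢ(x, …, x) = m! ∂ᵢ p(x)`, so the diagonal and `n - B`
  generic integral hyperplanes in it cut the cone `Φ = 0` down to the origin
  (`exists_linForm_cut`, by prime avoidance). By the Nullstellensatz the `m * n - B` integral linear
  forms in question then have fibres of bounded size on this cone
  (`exists_card_integral_points_le`).
-/

open MvPolynomial

namespace BirchCount

/-! ### Cutting a cone by integral hyperplanes -/

/-- The linear form `∑ vᵢ Xᵢ` over `ℂ` with integral coefficients `vᵢ`. -/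
noncomputable def linForm {σ : Type*} [Fintype σ] (v : σ → ℤ) : MvPolynomial σ ℂ :=
  ∑ i, C (v i : ℂ) * X i

lemma aeval_linForm {σ : Type*} [Fintype σ] (v : σ → ℤ) (z : σ → ℂ) :
    aeval z (linForm v) = ∑ i, (v i : ℂ) * z i := by
  simp [linForm]

/-- Prime avoidance for integral linear forms: the rational coefficient vectors of forms in `P k` are
a proper subspace of `ℚ^σ`, and finitely many of these do not cover it. -/
lemma exists_linForm_notMem {σ ι : Type*} [Fintype σ] [Finite ι]
    (P : ι → Ideal (MvPolynomial σ ℂ)) (hP : ∀ k, ∃ i, X i ∉ P k) :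
    ∃ v : σ → ℤ, ∀ k, linForm v ∉ P k := by
  classical
  let φ : (σ → ℚ) →ₗ[ℚ] MvPolynomial σ ℂ :=
    { toFun := fun v => ∑ i, C (v i : ℂ) * X i
      map_add' := fun v w => by simp [add_mul, Finset.sum_add_distrib]
      map_smul' := fun c v => by
        simp only [Pi.smul_apply, smul_eq_mul, Rat.cast_mul, RingHom.id_apply, Finset.smul_sum]
        refine Finset.sum_congr rfl fun i _ => ?_
        rw [Algebra.smul_def, IsScalarTower.algebraMap_apply ℚ ℂ (MvPolynomial σ ℂ),
          ← mul_assoc, C_mul]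
        rfl }
  let W : ι → Subspace ℚ (σ → ℚ) := fun k => ((P k).restrictScalars ℚ).comap φ
  have hne : ⋃ k, (W k : Set (σ → ℚ)) ≠ Set.univ := by
    intro h
    obtain ⟨k, hk⟩ := Subspace.exists_eq_top_of_iUnion_eq_univ h
    obtain ⟨i, hi⟩ := hP k
    apply hi
    have : Pi.single i (1 : ℚ) ∈ W k := hk ▸ Submodule.mem_top
    have h2 : φ (Pi.single i 1) ∈ P k := this
    have h3 : φ (Pi.single i 1) = X i := by
      change ∑ j, C (((Pi.single i (1 : ℚ) : σ → ℚ) j : ℚ) : ℂ) * X j = _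
      rw [Finset.sum_eq_single i] <;> simp +contextual
    rwa [h3] at h2
  obtain ⟨w, hw⟩ := (Set.ne_univ_iff_exists_notMem _).1 hne
  -- clear denominators
  obtain ⟨⟨b, hb0⟩, hb⟩ := IsLocalization.exist_integer_multiples_of_finite (nonZeroDivisors ℤ) w
  choose v hv using hb
  refine ⟨v, fun k hk => hw (Set.mem_iUnion.2 ⟨k, ?_⟩)⟩
  have hb0 : (b : ℚ) ≠ 0 := by exact_mod_cast nonZeroDivisors.ne_zero hb0
  have h1 : linForm v = φ ((b : ℚ) • w) := by
    change _ = ∑ j, C ((((b : ℚ) • w) j : ℚ) : ℂ) * X j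
    refine Finset.sum_congr rfl fun i _ => ?_
    have := hv i
    simp only [eq_intCast, zsmul_eq_mul] at this
    rw [Pi.smul_apply, smul_eq_mul, ← this]
    simp
  have h2 : (b : ℚ) • w ∈ W k := by
    change φ _ ∈ P k
    rwa [← h1]
  exact ((W k).smul_mem_iff hb0).1 h2

/-- In `ℂ[x₁, …, xₙ]`, the height of a proper ideal is at most `n`. -/
lemma height_le_of_ne_top {n : ℕ} {I : Ideal (MvPolynomial (Fin n) ℂ)} (hI : I ≠ ⊤) :
    I.height ≤ n := by
  have h := Ideal.height_le_ringKrullDim_of_ne_top hI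
  rw [MvPolynomial.ringKrullDim_of_isNoetherianRing, ringKrullDim_eq_zero_of_field] at h
  rw [zero_add, Nat.card_eq_fintype_card, Fintype.card_fin] at h
  exact WithBot.coe_le_coe.1 h

/-- Away from the ideal of the origin, generic integral hyperplanes raise the height by one each. -/
lemma exists_linForm_height {n b : ℕ} (I : Ideal (MvPolynomial (Fin n) ℂ))
    (hb : (b : ℕ∞) ≤ I.height) (j : ℕ) :
    ∃ l : Fin j → Fin n → ℤ, ∀ Q : Ideal (MvPolynomial (Fin n) ℂ), Q.IsPrime →
      (∃ i, X i ∉ Q) → I ≤ Q → (∀ t, linForm (l t) ∈ Q) → ((b + j : ℕ) : ℕ∞) ≤ Q.height := by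
  induction j with
  | zero =>
    exact ⟨fun _ _ => 0, fun Q _ _ hQ _ => by simpa using hb.trans (Ideal.height_mono hQ)⟩
  | succ j ih =>
    obtain ⟨l, hl⟩ := ih
    set J := I ⊔ Ideal.span (Set.range fun t => linForm (l t)) with hJ
    have hJle : ∀ Q : Ideal (MvPolynomial (Fin n) ℂ), J ≤ Q ↔ I ≤ Q ∧ ∀ t, linForm (l t) ∈ Q := by
      intro Q
      rw [hJ, sup_le_iff, Ideal.span_le, Set.range_subset_iff]
      rfl
    have hfin : Finite {P : Ideal (MvPolynomial (Fin n) ℂ) //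
        P ∈ J.minimalPrimes ∧ ∃ i, X i ∉ P} :=
      ((J.finite_minimalPrimes_of_isNoetherianRing).subset fun P hP => hP.1).to_subtype
    obtain ⟨v, hv⟩ := exists_linForm_notMem
      (fun P : {P : Ideal (MvPolynomial (Fin n) ℂ) // P ∈ J.minimalPrimes ∧ ∃ i, X i ∉ P} => P.1)
      (fun P => P.2.2)
    refine ⟨Fin.snoc l v, fun Q hQ hXQ hIQ hlQ => ?_⟩
    have hvQ : linForm v ∈ Q := by simpa using hlQ (Fin.last j)
    have hJQ : J ≤ Q := (hJle Q).2 ⟨hIQ, fun t => by simpa using hlQ t.castSucc⟩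
    obtain ⟨P, hP, hPQ⟩ := Ideal.exists_minimalPrimes_le hJQ
    have hPp : P.IsPrime := hP.1.1
    have hXP : ∃ i, X i ∉ P := hXQ.imp fun i hi h => hi (hPQ h)
    have hPh : ((b + j : ℕ) : ℕ∞) ≤ P.height :=
      hl P hPp hXP ((hJle P).1 hP.1.2).1 ((hJle P).1 hP.1.2).2
    have hlt : P < Q := lt_of_le_of_ne hPQ fun h => hv ⟨P, hP, hXP⟩ (h ▸ hvQ)
    calc ((b + (j + 1) : ℕ) : ℕ∞) = ((b + j : ℕ) : ℕ∞) + 1 := by push_cast; ring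
      _ ≤ P.height + 1 := by gcongr
      _ ≤ Q.height := Ideal.height_add_one_le_of_lt_of_isPrime hlt

/-- A cone of codimension at least `b` in `ℂⁿ` meets the common zero locus of `n - b` suitable
integral linear forms in the origin only. -/
lemma exists_linForm_cut {n b : ℕ} (S : Set (Fin n → ℂ)) (h0 : (0 : Fin n → ℂ) ∈ S)
    (hS : ∀ (t : ℂ), ∀ z ∈ S, t • z ∈ S) (hb : (b : ℕ∞) ≤ (vanishingIdeal ℂ S).height) :
    b ≤ n ∧ ∃ l : Fin (n - b) → Fin n → ℤ, ∀ z ∈ S, (∀ t, ∑ i, (l t i : ℂ) * z i = 0) → z = 0 := by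
  have hbn : b ≤ n := by
    have : vanishingIdeal ℂ S ≠ ⊤ := by
      rw [Ne, Ideal.eq_top_iff_one, mem_vanishingIdeal_iff]
      intro h
      simpa using h 0 h0
    exact_mod_cast hb.trans (height_le_of_ne_top this)
  obtain ⟨l, hl⟩ := exists_linForm_height (vanishingIdeal ℂ S) hb (n - b)
  refine ⟨hbn, l, fun z hz hlz => ?_⟩
  by_contra hne
  set J := vanishingIdeal ℂ S ⊔ Ideal.span (Set.range fun t => linForm (l t)) with hJ
  have hJle : ∀ Q : Ideal (MvPolynomial (Fin n) ℂ),
      J ≤ Q ↔ vanishingIdeal ℂ S ≤ Q ∧ ∀ t, linForm (l t) ∈ Q := by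
    intro Q
    rw [hJ, sup_le_iff, Ideal.span_le, Set.range_subset_iff]
    rfl
  obtain ⟨i, hi⟩ := Function.ne_iff.1 hne
  -- the points `(t + 1) • z` of the line through `z` give infinitely many minimal primes over `J`
  let Q : ℕ → Ideal (MvPolynomial (Fin n) ℂ) := fun t => vanishingIdeal ℂ {((t + 1 : ℕ) : ℂ) • z}
  have hQmax : ∀ t, (Q t).IsMaximal := fun t =>
    isMaximal_iff_eq_vanishingIdeal_singleton.2 ⟨_, rfl⟩
  have hQJ : ∀ t, J ≤ Q t := fun t => (hJle _).2
    ⟨vanishingIdeal_anti_mono (by simpa using hS _ z hz), fun s => by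
      rw [mem_vanishingIdeal_singleton_iff, aeval_linForm]
      simp only [Pi.smul_apply, smul_eq_mul, mul_left_comm _ ((t + 1 : ℕ) : ℂ), ← Finset.mul_sum,
        hlz s, mul_zero]⟩
  have hQmin : ∀ t, Q t ∈ J.minimalPrimes := by
    intro t
    have := (hQmax t).isPrime
    obtain ⟨P, hP, hPQ⟩ := Ideal.exists_minimalPrimes_le (hQJ t)
    have hPp : P.IsPrime := hP.1.1
    rcases eq_or_lt_of_le hPQ with rfl | hlt
    · exact hP
    · exfalso
      have hXP : X i ∉ P := fun h => by
        have := hPQ h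
        rw [mem_vanishingIdeal_singleton_iff, aeval_X, Pi.smul_apply, smul_eq_mul] at this
        exact mul_ne_zero (Nat.cast_ne_zero.2 t.succ_ne_zero) hi this
      have h1 := hl P hPp ⟨i, hXP⟩ ((hJle P).1 hP.1.2).1 ((hJle P).1 hP.1.2).2
      have h2 := Ideal.height_add_one_le_of_lt_of_isPrime hlt
      have h3 := height_le_of_ne_top (hQmax t).ne_top
      have h4 : ((b + (n - b) : ℕ) : ℕ∞) + 1 ≤ n := (add_le_add_left h1 1).trans (h2.trans h3)
      have h5 : b + (n - b) + 1 ≤ n := by exact_mod_cast h4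
      omega
  have hQinj : Function.Injective Q := by
    intro s t hst
    have h1 : X i - C (((s + 1 : ℕ) : ℂ) * z i) ∈ Q s := by
      rw [mem_vanishingIdeal_singleton_iff]
      simp
    rw [hst, mem_vanishingIdeal_singleton_iff] at h1
    simp only [map_sub, aeval_X, Pi.smul_apply, smul_eq_mul, aeval_C, Algebra.algebraMap_self,
      RingHom.id_apply] at h1
    have h2 := mul_right_cancel₀ hi (sub_eq_zero.1 h1)
    exact (Nat.succ_injective (Nat.cast_injective h2)).symm
  exact Set.infinite_of_injective_forall_mem hQinj hQmin
    (J.finite_minimalPrimes_of_isNoetherianRing)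

/-! ### Integral points on a cone -/

/-- Finitely many points at which each `xᵢ ^ (e + 1)` agrees with a polynomial of degree at most
`e` number at most `(e + 1) ^ r` in an `r`-dimensional space: the monomials with exponents at most
`e` span the functions on them. -/
lemma card_le_of_pow_eq_eval {K τ : Type*} [Field K] [Fintype τ] (e : ℕ) (F : Finset (τ → K))
    (r : τ → MvPolynomial τ K) (hr : ∀ i, (r i).totalDegree ≤ e)
    (hF : ∀ i, ∀ z ∈ F, z i ^ (e + 1) = eval z (r i)) :
    F.card ≤ (e + 1) ^ Fintype.card τ := by
  classical
  let ev : MvPolynomial τ K →ₗ[K] (F → K) :=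
    LinearMap.pi fun z => (aeval (z : τ → K)).toLinearMap
  have ev_apply : ∀ p z, ev p z = eval (z : τ → K) p := fun p z => by
    simp [ev, aeval_eq_eval]
  let mon : (τ → Fin (e + 1)) → (F → K) := fun m => ev (∏ i, X i ^ (m i : ℕ))
  have hmon : ∀ N (s : τ →₀ ℕ), s.degree = N →
      ev (monomial s 1) ∈ Submodule.span K (Set.range mon) := by
    intro N
    induction N using Nat.strong_induction_on with
    | _ N ih =>
      intro s hs
      by_cases h : ∀ i, s i ≤ e
      · refine Submodule.subset_span ⟨fun i => ⟨s i, Nat.lt_succ_of_le (h i)⟩, ?_⟩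
        simp only [mon]
        rw [monomial_eq, C_1, one_mul, Finsupp.prod_fintype]
        simp
      · push Not at h
        obtain ⟨i, hi⟩ := h
        obtain ⟨s', rfl⟩ : ∃ s', s = Finsupp.single i (e + 1) + s' :=
          ⟨s - Finsupp.single i (e + 1), (add_tsub_cancel_of_le (by
            rw [Finsupp.single_le_iff]; exact hi)).symm⟩
        have h1 : ev (monomial (Finsupp.single i (e + 1) + s') 1) = ev (r i * monomial s' 1) := by
          ext z
          have h2 : (monomial (Finsupp.single i (e + 1) + s') (1 : K)) =
              X i ^ (e + 1) * monomial s' 1 := by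
            rw [X_pow_eq_monomial, monomial_mul, one_mul]
          rw [ev_apply, ev_apply, h2, map_mul, map_mul, map_pow, eval_X, hF i z z.2]
        rw [h1, as_sum (r i * monomial s' 1), map_sum]
        refine Submodule.sum_mem _ fun t ht => ?_
        have h3 : monomial t (coeff t (r i * monomial s' 1)) =
            coeff t (r i * monomial s' 1) • monomial t (1 : K) := by
          rw [smul_monomial, smul_eq_mul, mul_one]
        rw [h3, map_smul]
        refine Submodule.smul_mem _ _ (ih t.degree ?_ t rfl)
        rw [map_add, Finsupp.degree_single] at hs
        have h4 : t.degree ≤ (r i * monomial s' 1).totalDegree :=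
          le_totalDegree ht
        have h5 : (monomial s' (1 : K)).totalDegree ≤ s'.degree :=
          totalDegree_monomial_le s' (1 : K)
        have h6 := totalDegree_mul (r i) (monomial s' 1)
        have h7 := hr i
        omega
  have hspan : ∀ p, ev p ∈ Submodule.span K (Set.range mon) := by
    intro p
    rw [p.as_sum, map_sum]
    refine Submodule.sum_mem _ fun t _ => ?_
    have h3 : monomial t (coeff t p) = coeff t p • monomial t (1 : K) := by
      rw [smul_monomial, smul_eq_mul, mul_one]
    rw [h3, map_smul]
    exact Submodule.smul_mem _ _ (hmon _ t rfl)
  have hsurj : ∀ z : F, Pi.single z 1 ∈ Submodule.span K (Set.range mon) := by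
    -- Lagrange interpolation
    intro z
    have hq : ∀ w : F, ∃ q : MvPolynomial τ K, eval w.1 q = 0 ∧ (w ≠ z → eval z.1 q ≠ 0) := by
      intro w
      by_cases h : w = z
      · exact ⟨0, by simp, fun h' => (h' h).elim⟩
      · obtain ⟨i, hi⟩ := Function.ne_iff.1 (fun h' => h (Subtype.ext h') : w.1 ≠ z.1)
        exact ⟨X i - C (w.1 i), by simp, fun _ => by simpa [sub_eq_zero] using hi.symm⟩
    choose q hqw hqz using hq
    set P : MvPolynomial τ K := ∏ w ∈ Finset.univ.erase z, q w with hP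
    have h1 : eval z.1 P ≠ 0 := by
      rw [hP, map_prod, Finset.prod_ne_zero_iff]
      exact fun w hw => hqz w (Finset.ne_of_mem_erase hw)
    have h2 : ev P = (eval z.1 P) • Pi.single z (1 : K) := by
      ext w
      rw [ev_apply, Pi.smul_apply, smul_eq_mul]
      by_cases h : w = z
      · rw [h]; simp
      · rw [Pi.single_eq_of_ne h, mul_zero, hP, map_prod]
        exact Finset.prod_eq_zero (Finset.mem_erase.2 ⟨h, Finset.mem_univ w⟩) (hqw w)
    have h3 := hspan P
    rw [h2] at h3
    exact (Submodule.smul_mem_iff _ h1).1 h3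
  have htop : Submodule.span K (Set.range mon) = ⊤ := by
    rw [eq_top_iff]
    intro f _
    rw [pi_eq_sum_univ f]
    refine Submodule.sum_mem _ fun z _ => Submodule.smul_mem _ _ ?_
    convert hsurj z using 1
    ext w
    simp [Pi.single_apply, eq_comm]
  have h1 := finrank_range_le_card (R := K) mon
  rw [Set.finrank, htop, finrank_top, Module.finrank_fintype_fun_eq_card, Fintype.card_coe,
    Fintype.card_fun, Fintype.card_fin] at h1
  exact h1

attribute [local instance] MvPolynomial.gradedAlgebra in
/-- If homogeneous polynomials `Φ` and linear forms `y` have only the origin as a common zero, then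
on the zero locus of `Φ` a power of each coordinate lies in the ideal of the `y`, with homogeneous
cofactors. -/
lemma exists_pow_eq_sum_mul {ι κ τ : Type*} [Fintype κ] [Fintype τ]
    (Φ : ι → MvPolynomial τ ℂ) (m : ι → ℕ) (hΦ : ∀ a, (Φ a).IsHomogeneous (m a))
    (y : κ → MvPolynomial τ ℂ) (hy : ∀ k, (y k).IsHomogeneous 1)
    (h0 : ∀ z : τ → ℂ, (∀ a, eval z (Φ a) = 0) → (∀ k, eval z (y k) = 0) → z = 0) :
    ∃ e : ℕ, ∀ i, ∃ g : κ → MvPolynomial τ ℂ, (∀ k, (g k).totalDegree ≤ e) ∧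
      ∀ z, (∀ a, eval z (Φ a) = 0) → z i ^ (e + 1) = ∑ k, eval z (g k) * eval z (y k) := by
  classical
  set J : Ideal (MvPolynomial τ ℂ) := Ideal.span (Set.range Φ) ⊔ Ideal.span (Set.range y) with hJ
  have hrad : ∀ i, X i ∈ J.radical := by
    intro i
    rw [← vanishingIdeal_zeroLocus_eq_radical (K := ℂ), mem_vanishingIdeal_iff]
    intro z hz
    have hz0 : z = 0 := h0 z
      (fun a => by
        rw [← aeval_eq_eval]
        exact hz _ (hJ ▸ Ideal.mem_sup_left (Ideal.subset_span ⟨a, rfl⟩)))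
      (fun k => by
        rw [← aeval_eq_eval]
        exact hz _ (hJ ▸ Ideal.mem_sup_right (Ideal.subset_span ⟨k, rfl⟩)))
    simp [hz0]
  choose N hN using hrad
  refine ⟨∑ i, N i, fun i => ?_⟩
  set e := ∑ i, N i
  have hmem : (X i : MvPolynomial τ ℂ) ^ (e + 1) ∈ J :=
    J.pow_mem_of_pow_mem (hN i)
      ((Finset.single_le_sum (fun j _ => Nat.zero_le (N j)) (Finset.mem_univ i)).trans e.le_succ)
  rw [hJ] at hmem
  obtain ⟨a, ha, b, hb, hab⟩ := Submodule.mem_sup.1 hmem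
  obtain ⟨g, hg⟩ := (Ideal.mem_span_range_iff_exists_fun).1 hb
  have hhom : (Ideal.span (Set.range Φ)).IsHomogeneous (homogeneousSubmodule τ ℂ) := by
    apply Ideal.homogeneous_span
    rintro _ ⟨a, rfl⟩
    exact ⟨m a, hΦ a⟩
  refine ⟨fun k => homogeneousComponent e (g k),
    fun k => (homogeneousComponent_isHomogeneous e (g k)).totalDegree_le, fun z hz => ?_⟩
  have hcomp : ∀ k, homogeneousComponent (e + 1) (g k * y k) =
      homogeneousComponent e (g k) * y k := fun k => by
    have := DirectSum.coe_decompose_mul_of_right_mem_of_le (homogeneousSubmodule τ ℂ)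
      (a := g k) (hy k) (Nat.le_add_left 1 e)
    rw [← decomposition.decompose'_apply, ← decomposition.decompose'_apply]
    exact this
  have h1 := congrArg (homogeneousComponent (e + 1)) hab
  rw [homogeneousComponent_eq_self (isHomogeneous_X_pow i (e + 1)), map_add, ← hg, map_sum,
    Finset.sum_congr rfl fun k _ => hcomp k] at h1
  have ha' := homogeneousComponent_mem_of_mem hhom ha (e + 1)
  have hle : Ideal.span (Set.range Φ) ≤ RingHom.ker (eval z) := by
    rw [Ideal.span_le]
    rintro _ ⟨a, rfl⟩
    exact hz a
  have h2 := congrArg (eval z) h1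
  rw [map_add, (RingHom.mem_ker).1 (hle ha'), zero_add, map_sum, map_pow, eval_X] at h2
  rw [← h2]
  simp

/-- A cone that meets the common zero locus of the integral linear forms `w k`, `k ∈ κ`, in the
origin only has `O(T ^ #κ)` integral points with coordinates in `[-T, T]`. -/
lemma exists_card_integral_points_le {ι κ τ : Type*} [Fintype κ] [Fintype τ]
    (Φ : ι → MvPolynomial τ ℂ) (m : ι → ℕ) (hΦ : ∀ a, (Φ a).IsHomogeneous (m a))
    (w : κ → τ → ℤ)
    (h0 : ∀ z : τ → ℂ, (∀ a, eval z (Φ a) = 0) → (∀ k, ∑ i, (w k i : ℂ) * z i = 0) → z = 0) :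
    ∃ D : ℕ, ∀ T : ℕ, 1 ≤ T → ∀ F : Finset (τ → ℤ),
      (∀ z ∈ F, (∀ i, |z i| ≤ T) ∧ ∀ a, eval (fun i => (z i : ℂ)) (Φ a) = 0) →
      F.card ≤ D * T ^ Fintype.card κ := by
  classical
  have hev : ∀ (v : τ → ℤ) (z : τ → ℂ), eval z (linForm v) = ∑ i, (v i : ℂ) * z i := fun v z => by
    rw [← aeval_linForm, aeval_eq_eval]
  obtain ⟨e, he⟩ := exists_pow_eq_sum_mul Φ m hΦ (fun k => linForm (w k))
    (fun k => IsHomogeneous.sum _ _ _ fun i _ => by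
      simpa using (isHomogeneous_C τ (w k i : ℂ)).mul (isHomogeneous_X ℂ i))
    (fun z hz hz' => h0 z hz fun k => by rw [← hev]; exact hz' k)
  choose g hg hgz using he
  -- the values of each linear form on the box of size `T` are bounded by `B * T`
  set B : ℕ := ∑ k, ∑ i, (w k i).natAbs with hB
  refine ⟨(e + 1) ^ Fintype.card τ * (2 * B + 1) ^ Fintype.card κ, fun T hT F hF => ?_⟩
  let Y : (τ → ℤ) → (κ → ℤ) := fun z k => ∑ i, w k i * z i
  have hY : ∀ z ∈ F, Y z ∈ Fintype.piFinset fun _ : κ => Finset.Icc (-(B * T : ℤ)) (B * T) := by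
    intro z hz
    rw [Fintype.mem_piFinset]
    intro k
    rw [Finset.mem_Icc, ← abs_le]
    calc |∑ i, w k i * z i| ≤ ∑ i, |w k i * z i| := Finset.abs_sum_le_sum_abs _ _
      _ ≤ ∑ i, |w k i| * T := by
          refine Finset.sum_le_sum fun i _ => ?_
          rw [abs_mul]
          exact mul_le_mul_of_nonneg_left ((hF z hz).1 i) (abs_nonneg _)
      _ = ((∑ i, (w k i).natAbs : ℕ) : ℤ) * T := by
          rw [← Finset.sum_mul]; push_cast; rfl
      _ ≤ B * T := by
          refine mul_le_mul_of_nonneg_right ?_ (Int.natCast_nonneg T)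
          exact_mod_cast Finset.single_le_sum (f := fun k => ∑ i, (w k i).natAbs)
            (fun _ _ => Nat.zero_le _) (Finset.mem_univ k)
  have hfib : ∀ v ∈ Fintype.piFinset fun _ : κ => Finset.Icc (-(B * T : ℤ)) (B * T),
      (F.filter fun z => Y z = v).card ≤ (e + 1) ^ Fintype.card τ := by
    intro v _
    have hinj : Function.Injective fun (z : τ → ℤ) (i : τ) => (z i : ℂ) := fun z z' h => by
      ext i
      exact Int.cast_injective (α := ℂ) (congrFun h i)
    rw [← Finset.card_image_of_injective _ hinj]
    refine card_le_of_pow_eq_eval e _ (fun i => ∑ k, (v k : ℂ) • g i k) (fun i => ?_)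
      fun i z' hz' => ?_
    · exact totalDegree_finsetSum_le fun k _ => (totalDegree_smul_le _ _).trans (hg i k)
    · obtain ⟨z, hz, rfl⟩ := Finset.mem_image.1 hz'
      obtain ⟨hz, hzv⟩ := Finset.mem_filter.1 hz
      rw [hgz i _ (hF z hz).2, map_sum]
      refine Finset.sum_congr rfl fun k _ => ?_
      rw [hev, smul_eval, mul_comm, ← congrFun hzv k]
      push_cast [Y]
      rfl
  have h1 := Finset.card_le_mul_card_image_of_maps_to hY _ hfib
  refine h1.trans ?_
  rw [Fintype.card_piFinset, Finset.prod_const, Finset.card_univ, Int.card_Icc, mul_assoc, ← mul_pow]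
  refine Nat.mul_le_mul_left _ (Nat.pow_le_pow_left ?_ _)
  have : ((B : ℤ) * T + 1 - -(B * T)).toNat = 2 * B * T + 1 := by
    rw [show ((B : ℤ) * T + 1 - -(B * T)) = ((2 * B * T + 1 : ℕ) : ℤ) by push_cast; ring,
      Int.toNat_natCast]
  rw [this, add_mul]
  omega

/-! ### Directional derivatives and polar forms -/

section Polar

variable {σ A : Type*} [CommRing A]

/-- The polynomials of degree less than `m`, so that `m = 0` stands for the zero polynomial. -/
noncomputable def degreeLT (σ A : Type*) [CommRing A] (m : ℕ) : Submodule A (MvPolynomial σ A) :=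
  restrictSupport A {s | s.degree < m}

lemma degreeLT_mono {m m' : ℕ} (h : m ≤ m') : degreeLT σ A m ≤ degreeLT σ A m' :=
  restrictSupport_mono A fun _ hs => lt_of_lt_of_le hs h

lemma monomial_mem_degreeLT {m : ℕ} {s : σ →₀ ℕ} (hs : s.degree < m) (a : A) :
    monomial s a ∈ degreeLT σ A m :=
  (monomial_mem_restrictSupport A).2 (Or.inl hs)

lemma map_mem_of_monomial {M : Type*} [AddCommGroup M] [Module A M] {m : ℕ} (W : Submodule A M)
    (L : MvPolynomial σ A →ₗ[A] M) (hL : ∀ s : σ →₀ ℕ, s.degree < m → L (monomial s 1) ∈ W)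
    {f : MvPolynomial σ A} (hf : f ∈ degreeLT σ A m) : L f ∈ W := by
  have h : degreeLT σ A m ≤ W.comap L := by
    rw [degreeLT, restrictSupport_eq_span, Submodule.span_le]
    rintro _ ⟨s, hs, rfl⟩
    exact hL s hs
  exact h hf

lemma eq_zero_of_mem_degreeLT_zero {f : MvPolynomial σ A} (hf : f ∈ degreeLT σ A 0) : f = 0 := by
  have := map_mem_of_monomial ⊥ LinearMap.id (fun s hs => absurd hs (Nat.not_lt_zero _)) hf
  simpa using this

lemma eq_C_of_mem_degreeLT_one {f : MvPolynomial σ A} (hf : f ∈ degreeLT σ A 1) :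
    f = C (constantCoeff f) := by
  have := map_mem_of_monomial ⊥
    (LinearMap.id - (Algebra.linearMap A (MvPolynomial σ A)).comp (lcoeff A 0))
    (fun s hs => by
      have : s = 0 := (Finsupp.degree_eq_zero_iff s).1 (Nat.lt_one_iff.1 hs)
      subst this
      simp) hf
  simpa [sub_eq_zero, constantCoeff_eq] using this

lemma pderiv_mem_degreeLT {m : ℕ} (i : σ) {f : MvPolynomial σ A} (hf : f ∈ degreeLT σ A m) :
    pderiv i f ∈ degreeLT σ A (m - 1) := by
  suffices H : ∀ s : σ →₀ ℕ, s.degree < m →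
      (pderiv (R := A) i).toLinearMap (monomial s 1) ∈ degreeLT σ A (m - 1) by
    simpa only [Derivation.coeFn_coe] using map_mem_of_monomial _ _ H hf
  intro s hs
  rw [Derivation.coeFn_coe, pderiv_monomial]
  by_cases h : s i = 0
  · simp [h]
  · obtain ⟨s', rfl⟩ : ∃ s', s = Finsupp.single i 1 + s' :=
      ⟨s - Finsupp.single i 1, (add_tsub_cancel_of_le (by
        rw [Finsupp.single_le_iff]; omega)).symm⟩
    apply monomial_mem_degreeLT
    rw [add_tsub_cancel_left]
    rw [map_add, Finsupp.degree_single] at hs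
    omega

lemma X_add_C_mul_mem_degreeLT {m : ℕ} (i : σ) (a : A) {f : MvPolynomial σ A}
    (hf : f ∈ degreeLT σ A m) :
    (X i + C a) * f ∈ degreeLT σ A (m + 1) := by
  suffices H : ∀ s : σ →₀ ℕ, s.degree < m →
      LinearMap.mulLeft A (X i + C a) (monomial s 1) ∈ degreeLT σ A (m + 1) by
    simpa only [LinearMap.mulLeft_apply] using map_mem_of_monomial _ _ H hf
  intro s hs
  rw [LinearMap.mulLeft_apply, add_mul]
  refine Submodule.add_mem _ ?_ ?_
  · rw [X, monomial_mul]
    refine monomial_mem_degreeLT ?_ _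
    rw [map_add, Finsupp.degree_single]
    omega
  · rw [C_mul_monomial]
    exact monomial_mem_degreeLT (hs.trans m.lt_succ_self) _

/-- The derivative in the direction of the constant vector `h`. -/
noncomputable def dirDeriv (h : σ → A) : Derivation A (MvPolynomial σ A) (MvPolynomial σ A) :=
  mkDerivation A fun i => C (h i)

lemma sum_derivation_apply {ι : Type*} (s : Finset ι)
    (D : ι → Derivation A (MvPolynomial σ A) (MvPolynomial σ A)) (f : MvPolynomial σ A) :
    (∑ i ∈ s, D i) f = ∑ i ∈ s, D i f := by
  rw [← Derivation.coeFnAddMonoidHom_apply, map_sum, Finset.sum_apply]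
  rfl

lemma dirDeriv_apply [Fintype σ] (h : σ → A) (f : MvPolynomial σ A) :
    dirDeriv h f = ∑ i, h i • pderiv i f := by
  classical
  have : dirDeriv h = ∑ i, h i • pderiv i := by
    refine derivation_ext fun j => ?_
    rw [dirDeriv, mkDerivation_X, sum_derivation_apply]
    simp [pderiv_X, Pi.single_apply, smul_eq_C_mul]
  rw [this, sum_derivation_apply]
  rfl

lemma dirDeriv_pderiv (h : σ → A) (i : σ) (f : MvPolynomial σ A) :
    dirDeriv h (pderiv i f) = pderiv i (dirDeriv h f) := by
  classical
  have : ⁅dirDeriv h, (pderiv i : Derivation A (MvPolynomial σ A) (MvPolynomial σ A))⁆ = 0 := by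
    refine derivation_ext fun j => ?_
    rw [Derivation.commutator_apply]
    by_cases hij : j = i <;> simp [dirDeriv, pderiv_X, hij]
  have h2 := congrArg (fun D : Derivation A (MvPolynomial σ A) (MvPolynomial σ A) => D f) this
  simpa [Derivation.commutator_apply, sub_eq_zero] using h2

variable [Fintype σ]

lemma dirDeriv_mem_degreeLT {m : ℕ} (h : σ → A) {f : MvPolynomial σ A} (hf : f ∈ degreeLT σ A m) :
    dirDeriv h f ∈ degreeLT σ A (m - 1) := by
  rw [dirDeriv_apply]
  exact Submodule.sum_mem _ fun i _ => Submodule.smul_mem _ _ (pderiv_mem_degreeLT i hf)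

/-- The substitution `x ↦ x + h`. -/
noncomputable def translate (h : σ → A) : MvPolynomial σ A →ₐ[A] MvPolynomial σ A :=
  aeval fun i => X i + C (h i)

omit [Fintype σ] in
lemma eval_translate (h x : σ → A) (f : MvPolynomial σ A) :
    eval x (translate h f) = eval (x + h) f := by
  rw [translate, ← aeval_eq_eval, ← aeval_eq_eval, ← AlgHom.comp_apply, comp_aeval]
  congr 2
  ext i
  simp

/-- The remainder of Taylor's formula to first order, `f (x + h) - f x - ∂ₕ f x`, lowers the degree
by two. -/
lemma taylor_mem_degreeLT {m : ℕ} (h : σ → A) {f : MvPolynomial σ A} (hf : f ∈ degreeLT σ A m) :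
    translate h f - f - dirDeriv h f ∈ degreeLT σ A (m - 2) := by
  suffices H : ∀ N (s : σ →₀ ℕ), s.degree = N → translate h (monomial s 1) - monomial s 1 -
      dirDeriv h (monomial s 1) ∈ degreeLT σ A (N - 1) by
    have hlin := map_mem_of_monomial (degreeLT σ A (m - 2))
      ((translate h).toLinearMap - LinearMap.id - (dirDeriv h).toLinearMap) (fun s hs => by
        simp only [LinearMap.sub_apply, AlgHom.toLinearMap_apply, LinearMap.id_apply,
          Derivation.coeFn_coe]
        exact degreeLT_mono (by omega) (H _ s rfl)) hf
    simpa only [LinearMap.sub_apply, AlgHom.toLinearMap_apply, LinearMap.id_apply,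
          Derivation.coeFn_coe] using hlin
  intro N
  induction N with
  | zero =>
    intro s hs
    have : s = 0 := (Finsupp.degree_eq_zero_iff s).1 hs
    subst this
    have h1 : (monomial (0 : σ →₀ ℕ)) (1 : A) = 1 := rfl
    rw [h1, map_one, Derivation.map_one_eq_zero, sub_self, sub_self]
    exact Submodule.zero_mem _
  | succ N ih =>
    intro s hs
    obtain ⟨i, hi⟩ : ∃ i, s i ≠ 0 := by
      by_contra! h0
      have : s = 0 := Finsupp.ext h0
      simp [this] at hs
    obtain ⟨s', rfl⟩ : ∃ s', s = Finsupp.single i 1 + s' :=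
      ⟨s - Finsupp.single i 1, (add_tsub_cancel_of_le (by
        rw [Finsupp.single_le_iff]; omega)).symm⟩
    have hs' : s'.degree = N := by
      rw [map_add, Finsupp.degree_single] at hs
      omega
    have h1 : (monomial (Finsupp.single i 1 + s') (1 : A)) = X i * monomial s' 1 := by
      rw [X, monomial_mul, one_mul]
    have h2 : translate h (X i) = X i + C (h i) := by simp [translate]
    have h3 : dirDeriv h (X i) = C (h i) := by simp [dirDeriv]
    have h4 : translate h (X i * monomial s' 1) - X i * monomial s' 1 -
        dirDeriv h (X i * monomial s' 1) = h i • dirDeriv h (monomial s' 1) +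
        (X i + C (h i)) * (translate h (monomial s' 1) - monomial s' 1 -
          dirDeriv h (monomial s' 1)) := by
      rw [map_mul, h2, Derivation.leibniz, h3, smul_eq_C_mul]
      simp only [smul_eq_mul]
      ring
    rw [h1, h4]
    refine Submodule.add_mem _ (Submodule.smul_mem _ _ ?_) ?_
    · exact dirDeriv_mem_degreeLT h (monomial_mem_degreeLT (by omega) _)
    · have h5 := ih s' hs'
      rcases N with _ | N
      · rw [eq_zero_of_mem_degreeLT_zero h5, mul_zero]
        exact Submodule.zero_mem _
      · exact X_add_C_mul_mem_degreeLT i (h i) h5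

/-- The constant term of the iterated derivative of a polynomial in the directions
`h 0, …, h (k - 1)`. For a form of degree `k` this is `k!` times its polarisation. -/
noncomputable def polar : (k : ℕ) → (Fin k → σ → A) → (MvPolynomial σ A →ₗ[A] A)
  | 0, _ => lcoeff A 0
  | k + 1, h => (polar k (Fin.tail h)).comp (dirDeriv (h 0)).toLinearMap

omit [Fintype σ] in
lemma polar_succ (k : ℕ) (h : Fin (k + 1) → σ → A) (f : MvPolynomial σ A) :
    polar (k + 1) h f = polar k (Fin.tail h) (dirDeriv (h 0) f) := rfl

omit [Fintype σ] in
lemma polar_zero (h : Fin 0 → σ → A) (f : MvPolynomial σ A) :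
    polar 0 h f = constantCoeff f := rfl

lemma polar_eq_zero {k : ℕ} (h : Fin k → σ → A) {f : MvPolynomial σ A}
    (hf : f ∈ degreeLT σ A k) : polar k h f = 0 := by
  induction k generalizing f with
  | zero => rw [eq_zero_of_mem_degreeLT_zero hf, map_zero]
  | succ k ih =>
    rw [polar_succ]
    exact ih _ (dirDeriv_mem_degreeLT (h 0) hf)

/-- The coefficients of the polar form: constant terms of iterated partial derivatives. -/
noncomputable def polarCoeff : (k : ℕ) → MvPolynomial σ A → (Fin k → σ) → A
  | 0, f, _ => constantCoeff f
  | k + 1, f, j => polarCoeff k (pderiv (j 0) f) (Fin.tail j)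

lemma polar_eq_sum (k : ℕ) (h : Fin k → σ → A) (f : MvPolynomial σ A) :
    polar k h f = ∑ j : Fin k → σ, polarCoeff k f j * ∏ l, h l (j l) := by
  induction k generalizing f with
  | zero => simp [polar_zero, polarCoeff]
  | succ k ih =>
    rw [polar_succ, dirDeriv_apply, map_sum,
      ← (Fin.consEquiv fun _ : Fin (k + 1) => σ).sum_comp, Fintype.sum_prod_type]
    refine Finset.sum_congr rfl fun i _ => ?_
    rw [map_smul, ih, smul_eq_mul, Finset.mul_sum]
    refine Finset.sum_congr rfl fun j _ => ?_
    rw [Fin.prod_univ_succ]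
    change _ = polarCoeff k (pderiv i f) j * (h 0 i * ∏ l, h (Fin.succ l) (j l))
    simp only [Fin.tail]
    ring

omit [Fintype σ] in
lemma polarCoeff_map {B : Type*} [CommRing B] (φ : A →+* B) (k : ℕ) (f : MvPolynomial σ A)
    (j : Fin k → σ) : polarCoeff k (map φ f) j = φ (polarCoeff k f j) := by
  induction k generalizing f with
  | zero => simp [polarCoeff]
  | succ k ih =>
    simp only [polarCoeff]
    rw [pderiv_map, ih]

/-- On the diagonal the polar form of a form `f` of degree `k` is `k! f`, by Euler's identity. -/
lemma polar_diag (k : ℕ) (x : σ → A) {f : MvPolynomial σ A} (hf : f.IsHomogeneous k) :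
    polar k (fun _ => x) f = (k.factorial : A) * eval x f := by
  induction k generalizing f with
  | zero =>
    rw [polar_zero, Nat.factorial_zero, Nat.cast_one, one_mul, constantCoeff_eq]
    conv_rhs => rw [totalDegree_eq_zero_iff_eq_C.1 (Nat.le_zero.1 hf.totalDegree_le), eval_C]
  | succ k ih =>
    have h1 : (dirDeriv x f).IsHomogeneous k := by
      rw [dirDeriv_apply]
      refine IsHomogeneous.sum _ _ _ fun i _ => ?_
      rw [smul_eq_C_mul]
      simpa using (isHomogeneous_C σ (x i)).mul (hf.pderiv (i := i))
    have h2 := congrArg (eval x) hf.sum_X_mul_pderiv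
    have h3 : eval x (dirDeriv x f) = (k + 1 : ℕ) * eval x f := by
      rw [dirDeriv_apply, map_sum]
      simpa [smul_eval] using h2
    rw [polar_succ]
    refine (ih h1).trans ?_
    rw [h3, Nat.factorial_succ]
    push_cast
    ring

end Polar

/-! ### Weyl differencing -/

section Weyl

variable {σ R : Type*} [Fintype σ] [DecidableEq σ] [CommRing R] [Fintype R]

/-- The complete exponential sum of a polynomial over a finite ring. -/
noncomputable def expSum (ψ : AddChar R ℂ) (f : MvPolynomial σ R) : ℂ :=
  ∑ x : σ → R, ψ (eval x f)

lemma norm_expSum_le (ψ : AddChar R ℂ) (f : MvPolynomial σ R) :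
    ‖expSum ψ f‖ ≤ Fintype.card (σ → R) := by
  refine (norm_sum_le _ _).trans ?_
  simp [AddChar.norm_apply]

lemma expSum_eq_zero {ψ : AddChar R ℂ} (hψ : ψ.IsPrimitive) {f : MvPolynomial σ R}
    (hf : f ∈ degreeLT σ R 2) {i : σ} (hi : constantCoeff (pderiv i f) ≠ 0) : expSum ψ f = 0 := by
  obtain ⟨t, ht⟩ := AddChar.ne_one_iff.1 (hψ hi)
  have h1 : ∀ x : σ → R, eval (x + Pi.single i t) f = eval x f + constantCoeff (pderiv i f) * t := by
    intro x
    have h2 := taylor_mem_degreeLT (Pi.single i t) hf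
    rw [Nat.sub_self] at h2
    replace h2 := eq_zero_of_mem_degreeLT_zero h2
    rw [sub_sub, sub_eq_zero] at h2
    rw [← eval_translate, h2, map_add, dirDeriv_apply, map_sum, Finset.sum_eq_single i]
    · have h3 : pderiv i f ∈ degreeLT σ R 1 := pderiv_mem_degreeLT i hf
      rw [smul_eval, Pi.single_eq_same, eq_C_of_mem_degreeLT_one h3, eval_C, constantCoeff_C,
        mul_comm t]
    · intro j _ hj
      rw [Pi.single_eq_of_ne hj, zero_smul, map_zero]
    · simp
  have h3 : expSum ψ f = expSum ψ f * ψ (constantCoeff (pderiv i f) * t) := by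
    conv_lhs => rw [expSum, ← Equiv.sum_comp (Equiv.addRight (Pi.single i t))]
    rw [expSum, Finset.sum_mul]
    refine Finset.sum_congr rfl fun x _ => ?_
    rw [Equiv.coe_addRight, h1, AddChar.map_add_eq_mul]
  by_contra h
  exact ht (mul_left_cancel₀ h (h3.symm.trans (mul_one _).symm))

lemma norm_expSum_sq_le (ψ : AddChar R ℂ) (f : MvPolynomial σ R) :
    ‖expSum ψ f‖ ^ 2 ≤ ∑ h : σ → R, ‖expSum ψ (translate h f - f)‖ := by
  have h1 : expSum ψ f * (starRingEnd ℂ) (expSum ψ f) =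
      ∑ h : σ → R, expSum ψ (translate h f - f) := by
    simp only [expSum]
    rw [map_sum, Finset.mul_sum, Finset.sum_comm]
    refine Finset.sum_congr rfl fun x _ => ?_
    rw [Finset.sum_mul, ← Equiv.sum_comp (Equiv.addLeft x)]
    refine Finset.sum_congr rfl fun h _ => ?_
    rw [map_sub, eval_translate, sub_eq_add_neg, AddChar.map_add_eq_mul, AddChar.map_neg_eq_conj]
    rfl
  have h2 : ‖expSum ψ f‖ ^ 2 = ‖expSum ψ f * (starRingEnd ℂ) (expSum ψ f)‖ := by
    rw [norm_mul, RCLike.norm_conj, sq]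
  rw [h2, h1]
  exact norm_sum_le _ _

/-- Weyl's inequality over a finite ring: a large exponential sum forces many common zeros of the
polar forms of the partial derivatives. -/
lemma weyl_inequality {ψ : AddChar R ℂ} (hψ : ψ.IsPrimitive) (k : ℕ) {f : MvPolynomial σ R}
    (hf : f ∈ degreeLT σ R (k + 2)) :
    (Fintype.card (σ → R) : ℝ) ^ k * ‖expSum ψ f‖ ^ 2 ^ k ≤ (Fintype.card (σ → R) : ℝ) ^ 2 ^ k *
      {h : Fin k → σ → R | ∀ i, polar k h (pderiv i f) = 0}.ncard := by
  classical
  have hncard : ∀ (k : ℕ) (f : MvPolynomial σ R),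
      {h : Fin k → σ → R | ∀ i, polar k h (pderiv i f) = 0}.ncard =
        (Finset.univ.filter fun h : Fin k → σ → R => ∀ i, polar k h (pderiv i f) = 0).card :=
    fun k f => by rw [← Set.ncard_coe_finset]; simp
  rw [hncard]
  induction k generalizing f with
  | zero =>
    simp only [pow_zero, one_mul, pow_one, polar_zero]
    by_cases h : ∀ i, constantCoeff (pderiv i f) = 0
    · simpa [h] using norm_expSum_le ψ f
    · push Not at h
      obtain ⟨i, hi⟩ := h
      rw [expSum_eq_zero hψ hf hi, norm_zero]
      positivity
  | succ k ih =>
    set G : ℝ := (Fintype.card (σ → R) : ℝ) with hG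
    have hG0 : 0 < G := by
      rw [hG]; exact_mod_cast Fintype.card_pos
    have h1 : (∑ h : σ → R, ‖expSum ψ (translate h f - f)‖) ^ 2 ^ k * G ≤
        G ^ 2 ^ k * ∑ h : σ → R, ‖expSum ψ (translate h f - f)‖ ^ 2 ^ k := by
      obtain ⟨e, he⟩ : ∃ e, 2 ^ k = e + 1 :=
        ⟨2 ^ k - 1, (Nat.succ_pred_eq_of_pos (by positivity)).symm⟩
      have := pow_sum_div_card_le_sum_pow (s := (Finset.univ : Finset (σ → R)))
        (f := fun h => ‖expSum ψ (translate h f - f)‖) (fun _ _ => norm_nonneg _) e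
      rw [Finset.card_univ, ← hG, div_le_iff₀ (by positivity)] at this
      rw [he, pow_succ G]
      nlinarith [this]
    have h2 : ∀ h : σ → R, translate h f - f ∈ degreeLT σ R (k + 2) := by
      intro h
      have h3 := taylor_mem_degreeLT h hf
      have h4 := dirDeriv_mem_degreeLT h hf
      have : translate h f - f = (translate h f - f - dirDeriv h f) + dirDeriv h f := by ring
      rw [this]
      exact Submodule.add_mem _ (degreeLT_mono (by omega) h3) (degreeLT_mono (by omega) h4)
    have h3 : ∀ (h : σ → R) (h' : Fin k → σ → R) (i : σ),
        polar k h' (pderiv i (translate h f - f)) =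
          polar (k + 1) (Fin.cons h h') (pderiv i f) := by
      intro h h' i
      have h4 : pderiv i (translate h f - f - dirDeriv h f) ∈ degreeLT σ R k :=
        degreeLT_mono (by omega) (pderiv_mem_degreeLT i (taylor_mem_degreeLT h hf))
      have h5 := polar_eq_zero h' h4
      rw [map_sub, map_sub, sub_eq_zero] at h5
      rw [h5, polar_succ, Fin.cons_zero, Fin.tail_cons, dirDeriv_pderiv]
    have h4 : (Finset.univ.filter fun h : Fin (k + 1) → σ → R =>
        ∀ i, polar (k + 1) h (pderiv i f) = 0).card = ∑ h : σ → R,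
        (Finset.univ.filter fun h' : Fin k → σ → R =>
          ∀ i, polar k h' (pderiv i (translate h f - f)) = 0).card := by
      simp only [Finset.card_filter]
      rw [← (Fin.consEquiv fun _ : Fin (k + 1) => σ → R).sum_comp, Fintype.sum_prod_type]
      simp only [h3]
      rfl
    rw [h4, Nat.cast_sum]
    calc G ^ (k + 1) * ‖expSum ψ f‖ ^ 2 ^ (k + 1)
        = G ^ (k + 1) * (‖expSum ψ f‖ ^ 2) ^ 2 ^ k := by rw [← pow_mul, pow_succ 2, mul_comm (2 ^ k)]
      _ ≤ G ^ (k + 1) * (∑ h : σ → R, ‖expSum ψ (translate h f - f)‖) ^ 2 ^ k := by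
          gcongr
          exact norm_expSum_sq_le ψ f
      _ = G ^ k * ((∑ h : σ → R, ‖expSum ψ (translate h f - f)‖) ^ 2 ^ k * G) := by ring
      _ ≤ G ^ k * (G ^ 2 ^ k * ∑ h : σ → R, ‖expSum ψ (translate h f - f)‖ ^ 2 ^ k) := by gcongr
      _ = G ^ 2 ^ k * ∑ h : σ → R, G ^ k * ‖expSum ψ (translate h f - f)‖ ^ 2 ^ k := by
          rw [← Finset.mul_sum]; ring
      _ ≤ G ^ 2 ^ k * ∑ h : σ → R, G ^ 2 ^ k * ((Finset.univ.filter fun h' : Fin k → σ → R =>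
            ∀ i, polar k h' (pderiv i (translate h f - f)) = 0).card : ℝ) := by
          refine mul_le_mul_of_nonneg_left (Finset.sum_le_sum fun h _ => ih (h2 h)) ?_
          positivity
      _ = _ := by
          rw [← Finset.mul_sum, pow_succ 2, mul_two, pow_add, mul_assoc]

end Weyl

/-! ### Shrinking the variables of a system of multilinear congruences -/

/-- Pigeonhole in one group variable at a time: if `K` is, in each variable, closed under
differences, and `G` is partitioned into cells whose differences lie in `U`, then restricting all
variables to `U` costs a factor of at most the number of cells for each of them. -/
lemma ncard_le_card_pow_mul {ι G S : Type*} [Fintype ι] [DecidableEq ι] [AddCommGroup G] [Finite G]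
    [Finite S] (cell : G → S) (U : Set G) (hU : ∀ g g', cell g = cell g' → g - g' ∈ U)
    (K : Set (ι → G))
    (hK : ∀ h k g g', Function.update h k g ∈ K → Function.update h k g' ∈ K →
      Function.update h k (g - g') ∈ K) :
    K.ncard ≤ Nat.card S ^ Fintype.card ι * {h ∈ K | ∀ k, h k ∈ U}.ncard := by
  classical
  suffices H : ∀ s : Finset ι,
      K.ncard ≤ Nat.card S ^ s.card * {h ∈ K | ∀ k ∈ s, h k ∈ U}.ncard by
    simpa using H Finset.univ
  intro s
  induction s using Finset.induction_on with
  | empty => simp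
  | insert k s hk ih =>
    rw [Finset.card_insert_of_notMem hk, pow_succ, mul_assoc]
    refine ih.trans (Nat.mul_le_mul_left _ ?_)
    set A := {h ∈ K | ∀ k ∈ s, h k ∈ U} with hA
    set B := {h ∈ K | ∀ l ∈ insert k s, h l ∈ U} with hB
    -- a representative of the elements of a cell that are admissible in the `k`-th variable
    let rep : (ι → G) → S → G := fun h c =>
      Classical.epsilon fun g => Function.update h k g ∈ A ∧ cell g = c
    have hrep : ∀ h ∈ A, Function.update h k (rep h (cell (h k))) ∈ A ∧
        cell (rep h (cell (h k))) = cell (h k) := fun h hh =>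
      Classical.epsilon_spec (p := fun g => Function.update h k g ∈ A ∧ cell g = cell (h k))
        ⟨h k, by rwa [Function.update_eq_self], rfl⟩
    let φ : (ι → G) → S × (ι → G) := fun h =>
      (cell (h k), Function.update h k (h k - rep h (cell (h k))))
    have hφ : ∀ h ∈ A, φ h ∈ (Set.univ : Set S) ×ˢ B := by
      intro h hh
      obtain ⟨h1, h2⟩ := hrep h hh
      refine ⟨trivial, hK h k _ _ ?_ h1.1, fun l hl => ?_⟩
      · rw [Function.update_eq_self]
        exact hh.1
      · simp only [φ]
        by_cases hlk : l = k
        · subst hlk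
          simpa using hU _ _ h2.symm
        · rw [Function.update_of_ne hlk]
          exact hh.2 l (Finset.mem_of_mem_insert_of_ne hl hlk)
    have hinj : Set.InjOn φ A := by
      intro h hh h' hh' heq
      obtain ⟨h1, h2⟩ := Prod.mk.inj heq
      have h3 : h' = Function.update h k (h' k) := by
        ext l
        by_cases hlk : l = k
        · subst hlk; simp
        · have := congrFun h2 l
          rw [Function.update_of_ne hlk, Function.update_of_ne hlk] at this
          rw [Function.update_of_ne hlk, this]
      have h4 : rep h' (cell (h' k)) = rep h (cell (h k)) := by
        rw [← h1]
        conv_lhs => rw [h3]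
        simp only [rep, Function.update_idem]
      have h5 := congrFun h2 k
      rw [Function.update_self, Function.update_self, h4, sub_left_inj] at h5
      rw [h3, ← h5, Function.update_eq_self]
    have := Set.ncard_le_ncard_of_injOn φ hφ hinj (Set.toFinite _)
    rwa [Set.ncard_prod, Set.ncard_univ] at this

/-- The multilinear form with integral coefficients `t`, in variables from a commutative ring. -/
def multiForm {m : ℕ} {σ A : Type*} [Fintype σ] [CommRing A] (t : (Fin m → σ) → ℤ)
    (h : Fin m → σ → A) : A :=
  ∑ j, (t j : A) * ∏ l, h l (j l)

section MultiForm

variable {m : ℕ} {σ A : Type*} [Fintype σ] [CommRing A]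

lemma multiForm_update_sub (t : (Fin m → σ) → ℤ) (h : Fin m → σ → A) (k : Fin m) (g g' : σ → A) :
    multiForm t (Function.update h k (g - g')) =
      multiForm t (Function.update h k g) - multiForm t (Function.update h k g') := by
  classical
  have H : ∀ (g : σ → A) (j : Fin m → σ), ∏ l, Function.update h k g l (j l) =
      g (j k) * ∏ l ∈ Finset.univ \ {k}, h l (j l) := by
    intro g j
    rw [← Finset.prod_update_of_mem (Finset.mem_univ k)]
    refine Finset.prod_congr rfl fun l _ => ?_
    by_cases hl : l = k
    · subst hl; simp
    · simp [hl]
  simp only [multiForm, H, Pi.sub_apply, sub_mul, mul_sub, Finset.sum_sub_distrib]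

lemma multiForm_intCast (t : (Fin m → σ) → ℤ) (z : Fin m → σ → ℤ) :
    multiForm t (fun l i => (z l i : A)) = (multiForm t z : ℤ) := by
  simp [multiForm]

lemma abs_multiForm_le (t : (Fin m → σ) → ℤ) (z : Fin m → σ → ℤ) {T : ℕ}
    (hz : ∀ l i, |z l i| ≤ T) : |multiForm t z| ≤ (∑ j, (t j).natAbs : ℕ) * (T : ℤ) ^ m := by
  refine (Finset.abs_sum_le_sum_abs _ _).trans ?_
  push_cast
  rw [Finset.sum_mul]
  refine Finset.sum_le_sum fun j _ => ?_
  rw [abs_mul, Finset.abs_prod]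
  refine mul_le_mul_of_nonneg_left ?_ (abs_nonneg _)
  calc ∏ l, |z l (j l)| ≤ ∏ _l : Fin m, (T : ℤ) :=
        Finset.prod_le_prod (fun _ _ => abs_nonneg _) fun l _ => hz l (j l)
    _ = T ^ m := by simp

end MultiForm

/-- If `c T ^ m < r`, where `r` is the order of `a` modulo `q`, then the congruences
`a Φᵢ(h) ≡ 0` in variables of size at most `T` are equations over `ℤ`. -/
lemma ncard_congruence_mul_pow_le {n m b c D : ℕ} (t : Fin n → (Fin m → Fin n) → ℤ)
    (hc : ∀ i, ∑ j, (t i j).natAbs ≤ c) (hbm : b ≤ m * n)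
    (hD : ∀ T : ℕ, 1 ≤ T → ∀ F : Finset (Fin m × Fin n → ℤ),
      (∀ z ∈ F, (∀ x, |z x| ≤ T) ∧ ∀ i, multiForm (t i) (fun l x => z (l, x)) = 0) →
      F.card ≤ D * T ^ (m * n - b))
    {q : ℕ} [NeZero q] (a : ZMod q) {T : ℕ} (hT : 1 ≤ T) (hTq : T ≤ q)
    (hTr : c * T ^ m < addOrderOf a) :
    {h : Fin m → Fin n → ZMod q | ∀ i, a * multiForm (t i) h = 0}.ncard * T ^ b ≤
      D * (2 * q) ^ (m * n) := by
  classical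
  set K : Set (Fin m → Fin n → ZMod q) := {h | ∀ i, a * multiForm (t i) h = 0} with hKdef
  let cell : (Fin n → ZMod q) → (Fin n → Fin (q / T + 1)) := fun g i =>
    ⟨(g i).val / T, Nat.lt_succ_of_le (Nat.div_le_div_right (ZMod.val_lt _).le)⟩
  let U : Set (Fin n → ZMod q) := {g | ∃ z : Fin n → ℤ, (∀ i, |z i| ≤ T) ∧ ∀ i, g i = z i}
  have hU : ∀ g g', cell g = cell g' → g - g' ∈ U := by
    intro g g' h
    refine ⟨fun i => ((g i).val : ℤ) - (g' i).val, fun i => ?_, fun i => ?_⟩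
    · have h1 : (g i).val / T = (g' i).val / T := congrArg Fin.val (congrFun h i)
      have h2 := Nat.div_add_mod (g i).val T
      have h3 := Nat.div_add_mod (g' i).val T
      have h4 := Nat.mod_lt (g i).val hT
      have h5 := Nat.mod_lt (g' i).val hT
      rw [h1] at h2
      change |((g i).val : ℤ) - (g' i).val| ≤ T
      rw [abs_le]
      constructor <;> omega
    · simp
  have hK : ∀ h k g g', Function.update h k g ∈ K → Function.update h k g' ∈ K →
      Function.update h k (g - g') ∈ K := by
    intro h k g g' h1 h2 i
    rw [multiForm_update_sub, mul_sub, h1 i, h2 i, sub_zero]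
  have h1 := ncard_le_card_pow_mul cell U hU K hK
  -- the solutions in the box, lifted to `ℤ`
  let F : Finset (Fin m × Fin n → ℤ) :=
    (Fintype.piFinset fun _ => Finset.Icc (-(T : ℤ)) T).filter fun z =>
      ∀ i, multiForm (t i) (fun l x => z (l, x)) = 0
  have hF := hD T hT F fun z hz => by
    obtain ⟨hz, hz'⟩ := Finset.mem_filter.1 hz
    exact ⟨fun x => abs_le.2 (Finset.mem_Icc.1 (Fintype.mem_piFinset.1 hz x)), hz'⟩
  have h2 : {h ∈ K | ∀ k, h k ∈ U}.ncard ≤ F.card := by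
    let red : (Fin m × Fin n → ℤ) → (Fin m → Fin n → ZMod q) := fun z l x => (z (l, x) : ℤ)
    have : {h ∈ K | ∀ k, h k ∈ U} ⊆ ↑(F.image red) := by
      rintro h ⟨hhK, hhU⟩
      choose z hz hzh using hhU
      have hh : h = fun l x => ((z l x : ℤ) : ZMod q) := by
        ext l x
        exact hzh l x
      rw [Finset.mem_coe, Finset.mem_image]
      refine ⟨fun x => z x.1 x.2, ?_, hh.symm⟩
      rw [Finset.mem_filter, Fintype.mem_piFinset]
      refine ⟨fun x => Finset.mem_Icc.2 (abs_le.1 (hz _ _)), fun i => ?_⟩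
      have h3 := hhK i
      rw [hh, multiForm_intCast, mul_comm, ← zsmul_eq_mul,
        ← addOrderOf_dvd_iff_zsmul_eq_zero] at h3
      refine Int.eq_zero_of_abs_lt_dvd h3 ?_
      calc |multiForm (t i) z| ≤ (∑ j, (t i j).natAbs : ℕ) * (T : ℤ) ^ m :=
            abs_multiForm_le _ _ hz
        _ ≤ c * (T : ℤ) ^ m := by
            refine mul_le_mul_of_nonneg_right ?_ (by positivity)
            exact_mod_cast hc i
        _ < addOrderOf a := by exact_mod_cast hTr
    calc _ ≤ (↑(F.image red) : Set _).ncard := Set.ncard_le_ncard this (Finset.finite_toSet _)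
      _ = (F.image red).card := Set.ncard_coe_finset _
      _ ≤ F.card := Finset.card_image_le
  have hS : Nat.card (Fin n → Fin (q / T + 1)) ^ Fintype.card (Fin m) = (q / T + 1) ^ (m * n) := by
    rw [Nat.card_eq_fintype_card, Fintype.card_fun, Fintype.card_fin, Fintype.card_fin,
      Fintype.card_fin, ← pow_mul, mul_comm n m]
  rw [hS] at h1
  calc K.ncard * T ^ b ≤ ((q / T + 1) ^ (m * n) * (D * T ^ (m * n - b))) * T ^ b :=
        Nat.mul_le_mul_right _ (h1.trans (Nat.mul_le_mul_left _ (h2.trans hF)))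
    _ = D * ((q / T + 1) * T) ^ (m * n) := by
        rw [mul_pow, ← Nat.sub_add_cancel hbm]
        simp only [Nat.add_sub_cancel, pow_add]
        ring
    _ ≤ D * (2 * q) ^ (m * n) := by
        refine Nat.mul_le_mul_left _ (Nat.pow_le_pow_left ?_ _)
        have := Nat.div_mul_le_self q T
        rw [add_mul, one_mul]
        omega

/-- The number of solutions of the congruences `a Φᵢ(h) ≡ 0` modulo `q`, in terms of the order of
`a`, given the expected bound for the integral zeros of the `Φᵢ`. -/
lemma exists_ncard_congruence_pow_le {n m b D : ℕ} (hm : 1 ≤ m) (t : Fin n → (Fin m → Fin n) → ℤ)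
    (hbm : b ≤ m * n)
    (hD : ∀ T : ℕ, 1 ≤ T → ∀ F : Finset (Fin m × Fin n → ℤ),
      (∀ z ∈ F, (∀ x, |z x| ≤ T) ∧ ∀ i, multiForm (t i) (fun l x => z (l, x)) = 0) →
      F.card ≤ D * T ^ (m * n - b)) :
    ∃ M : ℕ, ∀ (q : ℕ) [NeZero q] (a : ZMod q),
      {h : Fin m → Fin n → ZMod q | ∀ i, a * multiForm (t i) h = 0}.ncard ^ m * addOrderOf a ^ b ≤
        M * (q ^ (m * n)) ^ m := by
  set c : ℕ := 1 + ∑ i, ∑ j, (t i j).natAbs with hcdef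
  have hc : ∀ i, ∑ j, (t i j).natAbs ≤ c := fun i =>
    (Finset.single_le_sum (f := fun i => ∑ j, (t i j).natAbs) (fun _ _ => Nat.zero_le _)
      (Finset.mem_univ i)).trans (Nat.le_add_left _ _)
  refine ⟨c ^ b + (c * 2 ^ m) ^ b * (D * 2 ^ (m * n)) ^ m, fun q _ a => ?_⟩
  set K := {h : Fin m → Fin n → ZMod q | ∀ i, a * multiForm (t i) h = 0}.ncard
  set r := addOrderOf a with hr
  have hrq : r ≤ q := by
    have := addOrderOf_le_card_univ (x := a)
    rwa [ZMod.card] at this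
  rcases le_or_gt r c with hrc | hrc
  · have hK : K ≤ q ^ (m * n) := by
      have := Set.ncard_le_card {h : Fin m → Fin n → ZMod q | ∀ i, a * multiForm (t i) h = 0}
      rwa [Nat.card_eq_fintype_card, Fintype.card_fun, Fintype.card_fun, Fintype.card_fin,
        Fintype.card_fin, ZMod.card, ← pow_mul, mul_comm n m] at this
    calc K ^ m * r ^ b ≤ (q ^ (m * n)) ^ m * c ^ b := by gcongr
      _ = c ^ b * (q ^ (m * n)) ^ m := mul_comm _ _
      _ ≤ _ := Nat.mul_le_mul_right _ (Nat.le_add_right _ _)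
  · -- take the largest `T` with `c T ^ m < r`
    have hex : ∃ T, r ≤ c * (T + 1) ^ m :=
      ⟨r, (Nat.le_succ r).trans ((Nat.le_self_pow (by omega) _).trans
        (Nat.le_mul_of_pos_left _ (by omega)))⟩
    classical
    obtain ⟨T, hT, hTmin⟩ : ∃ T, r ≤ c * (T + 1) ^ m ∧ ∀ T' < T, ¬ r ≤ c * (T' + 1) ^ m :=
      ⟨Nat.find hex, Nat.find_spec hex, fun T' h => Nat.find_min hex h⟩
    have hT1 : 1 ≤ T := by
      by_contra! h0
      have : T = 0 := by omega
      subst this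
      simp only [zero_add, one_pow, mul_one] at hT
      omega
    have hTr : c * T ^ m < r := by
      have := hTmin (T - 1) (by omega)
      rw [Nat.sub_add_cancel hT1] at this
      omega
    have hTq : T ≤ q := by
      have h1 : T ≤ T ^ m := Nat.le_self_pow (by omega) _
      have h2 : T ^ m ≤ c * T ^ m := Nat.le_mul_of_pos_left _ (by omega)
      omega
    have hmain : K * T ^ b ≤ D * (2 * q) ^ (m * n) :=
      ncard_congruence_mul_pow_le t hc hbm hD a hT1 hTq hTr
    have hr2 : r ≤ c * 2 ^ m * T ^ m := by
      refine hT.trans ?_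
      rw [mul_assoc, ← mul_pow]
      gcongr
      omega
    calc K ^ m * r ^ b ≤ K ^ m * (c * 2 ^ m * T ^ m) ^ b := by gcongr
      _ = (c * 2 ^ m) ^ b * (K * T ^ b) ^ m := by rw [mul_pow _ (T ^ m), mul_pow K]; ring
      _ ≤ (c * 2 ^ m) ^ b * (D * (2 * q) ^ (m * n)) ^ m := by gcongr
      _ = (c * 2 ^ m) ^ b * (D * 2 ^ (m * n)) ^ m * (q ^ (m * n)) ^ m := by
          rw [mul_pow 2 q, ← mul_assoc D, mul_pow (D * 2 ^ (m * n)), mul_assoc]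
      _ ≤ _ := Nat.mul_le_mul_right _ (Nat.le_add_left _ _)

/-! ### Zeros of the polar forms of the gradient -/

lemma degree_eq_of_mem_support {σ A : Type*} [CommRing A] {f : MvPolynomial σ A} {m : ℕ}
    (hf : f.IsHomogeneous m) {s : σ →₀ ℕ} (hs : s ∈ f.support) : s.degree = m :=
  (DFunLike.congr_fun Finsupp.degree_eq_weight_one s).trans (hf (mem_support_iff.1 hs))

lemma eval_smul_of_isHomogeneous {σ A : Type*} [Fintype σ] [CommRing A] {f : MvPolynomial σ A}
    {m : ℕ} (hf : f.IsHomogeneous m) (t : A) (z : σ → A) :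
    eval (t • z) f = t ^ m * eval z f := by
  rw [eval_eq', eval_eq', Finset.mul_sum]
  refine Finset.sum_congr rfl fun s hs => ?_
  have h1 : ∑ i, s i = m := by
    rw [← Finsupp.degree_eq_sum, degree_eq_of_mem_support hf hs]
  simp only [Pi.smul_apply, smul_eq_mul, mul_pow, Finset.prod_mul_distrib]
  rw [Finset.prod_pow_eq_pow_sum, h1]
  ring

lemma aeval_eq_eval_map {σ A : Type*} [CommRing A] (z : σ → A) (p : MvPolynomial σ ℤ) :
    aeval z p = eval z (map (Int.castRingHom A) p) := by
  rw [aeval_def, eval₂_eq_eval_map]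
  rfl

lemma polar_map_pderiv {σ A : Type*} [Fintype σ] [CommRing A] (m : ℕ) (p : MvPolynomial σ ℤ)
    (i : σ) (h : Fin m → σ → A) : polar m h (pderiv i (map (Int.castRingHom A) p)) =
      multiForm (polarCoeff m (pderiv i p)) h := by
  rw [polar_eq_sum, multiForm, pderiv_map]
  simp only [polarCoeff_map, eq_intCast]

/-- The integral zeros of size at most `T` of the polar forms of the gradient of `p` number
`O(T ^ (m * n - b))`: their zero locus meets the diagonal in the singular locus, so that it has
codimension at least `b`. -/
lemma exists_card_polar_zeros_le {n m b : ℕ} (hm : 1 ≤ m) {p : MvPolynomial (Fin n) ℤ}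
    (hp : p.IsHomogeneous (m + 1)) (hb : (b : ℕ∞) ≤ birchRank p) :
    b ≤ n ∧ ∃ D : ℕ, ∀ T : ℕ, 1 ≤ T → ∀ F : Finset (Fin m × Fin n → ℤ),
      (∀ z ∈ F, (∀ x, |z x| ≤ T) ∧
        ∀ i, multiForm (polarCoeff m (pderiv i p)) (fun l x => z (l, x)) = 0) →
      F.card ≤ D * T ^ (m * n - b) := by
  obtain ⟨m', rfl⟩ : ∃ m', m = m' + 1 := ⟨m - 1, (Nat.sub_add_cancel hm).symm⟩
  set pC := map (Int.castRingHom ℂ) p with hpC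
  have hhom : ∀ i, (pderiv i pC).IsHomogeneous (m' + 1) := fun i => by
    simpa using (hp.map (Int.castRingHom ℂ)).pderiv (i := i)
  have hsing : ∀ z, z ∈ singularLocus p ↔ ∀ i, eval z (pderiv i pC) = 0 := fun z => by
    simp only [singularLocus, Set.mem_ofPred_eq, aeval_eq_eval_map, hpC, pderiv_map]
  have hcone : ∀ (t : ℂ), ∀ z ∈ singularLocus p, t • z ∈ singularLocus p := by
    intro t z hz
    rw [hsing] at hz ⊢
    intro i
    rw [eval_smul_of_isHomogeneous (hhom i), hz i, mul_zero]
  have hzero : (0 : Fin n → ℂ) ∈ singularLocus p := by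
    rw [hsing]
    intro i
    have := eval_smul_of_isHomogeneous (hhom i) (0 : ℂ) 0
    rwa [zero_smul, zero_pow (Nat.succ_ne_zero _), zero_mul] at this
  obtain ⟨hbn, ℓ, hℓ⟩ := exists_linForm_cut (singularLocus p) hzero hcone hb
  refine ⟨hbn, ?_⟩
  let Φ : Fin n → MvPolynomial (Fin (m' + 1) × Fin n) ℂ := fun i =>
    ∑ j : Fin (m' + 1) → Fin n,
      C ((polarCoeff (m' + 1) (pderiv i p) j : ℤ) : ℂ) * ∏ l, X (l, j l)
  have hΦ : ∀ i, (Φ i).IsHomogeneous (m' + 1) := fun i => by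
    refine IsHomogeneous.sum _ _ _ fun j _ => ?_
    have h1 : (∏ l, X (l, j l) : MvPolynomial (Fin (m' + 1) × Fin n) ℂ).IsHomogeneous
        (∑ _l : Fin (m' + 1), 1) :=
      IsHomogeneous.prod _ _ _ fun l _ => isHomogeneous_X ℂ (l, j l)
    simpa using (isHomogeneous_C _ ((polarCoeff (m' + 1) (pderiv i p) j : ℤ) : ℂ)).mul h1
  have hΦeval : ∀ i z, eval z (Φ i) =
      multiForm (polarCoeff (m' + 1) (pderiv i p)) fun l x => z (l, x) := fun i z => by
    simp [Φ, multiForm, map_prod]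
  -- the diagonal is cut out by `m' n` linear forms, the origin on it by `n - b` more
  let w : (Fin m' × Fin n) ⊕ Fin (n - b) → Fin (m' + 1) × Fin n → ℤ :=
    Sum.elim (fun k => Pi.single (k.1.succ, k.2) 1 - Pi.single (0, k.2) 1)
      (fun s lx => if lx.1 = 0 then ℓ s lx.2 else 0)
  obtain ⟨D, hD⟩ := exists_card_integral_points_le Φ (fun _ => m' + 1) hΦ w fun z hz hw => by
    have hdiag : ∀ l x, z (l, x) = z (0, x) := by
      intro l x
      induction l using Fin.cases with
      | zero => rfl
      | succ k =>
        have := hw (Sum.inl (k, x))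
        simp only [w, Sum.elim_inl, Pi.sub_apply, Int.cast_sub, sub_mul, Finset.sum_sub_distrib]
          at this
        rw [Finset.sum_eq_single (k.succ, x) (fun y _ hy => by simp [hy]) (by simp),
          Finset.sum_eq_single ((0 : Fin (m' + 1)), x) (fun y _ hy => by simp [hy]) (by simp),
          Pi.single_eq_same, Pi.single_eq_same, Int.cast_one, one_mul, one_mul, sub_eq_zero] at this
        exact this
    have hx : (fun x => z (0, x)) ∈ singularLocus p := by
      rw [hsing]
      intro i
      have h1 := hz i
      have h2 : (fun (l : Fin (m' + 1)) x => z (l, x)) = fun _ x => z (0, x) := by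
        ext l x
        exact hdiag l x
      rw [hΦeval, h2, ← polar_map_pderiv, polar_diag _ _ (hhom i)] at h1
      exact (mul_eq_zero.1 h1).resolve_left (by exact_mod_cast Nat.factorial_ne_zero _)
    have h0 := hℓ _ hx fun s => by
      have := hw (Sum.inr s)
      rw [Fintype.sum_prod_type, Fin.sum_univ_succ] at this
      simpa [w, Fin.succ_ne_zero] using this
    ext ⟨l, x⟩
    rw [hdiag]
    exact congrFun h0 x
  refine ⟨D, fun T hT F hF => ?_⟩
  have hcard : Fintype.card ((Fin m' × Fin n) ⊕ Fin (n - b)) = (m' + 1) * n - b := by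
    rw [Fintype.card_sum, Fintype.card_prod, Fintype.card_fin, Fintype.card_fin, Fintype.card_fin,
      add_mul, one_mul, Nat.add_sub_assoc hbn]
  rw [← hcard]
  refine hD T hT F fun z hz => ⟨(hF z hz).1, fun i => ?_⟩
  rw [hΦeval, multiForm_intCast _ (fun l x => z (l, x)), (hF z hz).2 i, Int.cast_zero]

/-! ### The exponential sums and the number of solutions -/

/-- The exponential sums attached to `p` modulo `q` save more than the square of the order of the
frequency. -/
lemma exists_norm_expSum_pow_le {n m : ℕ} (hm : 1 ≤ m) {p : MvPolynomial (Fin n) ℤ}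
    (hp : p.IsHomogeneous (m + 1))
    (hB : ((2 * (2 ^ m * m) + 1 : ℕ) : ℕ∞) ≤ birchRank p) :
    ∃ M : ℕ, ∀ (q : ℕ) [NeZero q] (a : ZMod q),
      (‖expSum ZMod.stdAddChar (a • map (Int.castRingHom (ZMod q)) p)‖ / (q : ℝ) ^ n) ^ (2 ^ m * m)
        * (addOrderOf a : ℝ) ^ (2 * (2 ^ m * m) + 1) ≤ M := by
  set b := 2 * (2 ^ m * m) + 1 with hb
  obtain ⟨hbn, D, hD⟩ := exists_card_polar_zeros_le hm hp hB
  obtain ⟨M, hM⟩ := exists_ncard_congruence_pow_le (D := D) hm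
    (fun i => polarCoeff m (pderiv i p)) (hbn.trans (Nat.le_mul_of_pos_left n hm)) hD
  refine ⟨M, fun q _ a => ?_⟩
  set f := a • map (Int.castRingHom (ZMod q)) p with hf
  have hfdeg : f ∈ degreeLT (Fin n) (ZMod q) (m + 2) := by
    refine Submodule.smul_mem _ _ ?_
    rw [degreeLT, mem_restrictSupport_iff]
    intro s hs
    have h1 := degree_eq_of_mem_support (hp.map (Int.castRingHom (ZMod q))) hs
    change s.degree < m + 2
    omega
  have hweyl := weyl_inequality (ZMod.isPrimitive_stdAddChar q) m hfdeg
  have hcard : (Fintype.card (Fin n → ZMod q) : ℝ) = (q : ℝ) ^ n := by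
    rw [Fintype.card_fun, ZMod.card, Fintype.card_fin, Nat.cast_pow]
  set K := {h : Fin m → Fin n → ZMod q |
    ∀ i, a * multiForm (polarCoeff m (pderiv i p)) h = 0}.ncard with hK
  have hKeq : {h : Fin m → Fin n → ZMod q | ∀ i, polar m h (pderiv i f) = 0}.ncard = K := by
    simp only [hf, hK, Derivation.map_smul, map_smul, polar_map_pderiv, smul_eq_mul]
  rw [hKeq, hcard] at hweyl
  have hq : (0 : ℝ) < q := by exact_mod_cast NeZero.pos q
  set G : ℝ := (q : ℝ) ^ n with hG
  have hG0 : 0 < G := by positivity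
  have h1 : (‖expSum ZMod.stdAddChar f‖ / G) ^ 2 ^ m ≤ K / G ^ m := by
    rw [div_pow, div_le_div_iff₀ (by positivity) (by positivity)]
    linarith
  have h2 : (K : ℝ) ^ m * (addOrderOf a : ℝ) ^ b ≤ M * (G ^ m) ^ m := by
    have h3 : ((K ^ m * addOrderOf a ^ b : ℕ) : ℝ) ≤ ((M * (q ^ (m * n)) ^ m : ℕ) : ℝ) := by
      exact_mod_cast hM q a
    push_cast at h3
    rwa [hG, ← pow_mul (q : ℝ) n m, mul_comm n m]
  calc (‖expSum ZMod.stdAddChar f‖ / G) ^ (2 ^ m * m) * (addOrderOf a : ℝ) ^ b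
      ≤ (K / G ^ m) ^ m * (addOrderOf a : ℝ) ^ b := by
        rw [pow_mul]
        gcongr
    _ = (K : ℝ) ^ m * (addOrderOf a : ℝ) ^ b / (G ^ m) ^ m := by rw [div_pow]; ring
    _ ≤ M := (div_le_iff₀ (by positivity)).2 h2

/-- Detecting the equation by additive characters. -/
lemma mul_solutionCount_le {n : ℕ} (p : MvPolynomial (Fin n) ℤ) (q : ℕ) [NeZero q] :
    (q : ℝ) * solutionCount p q ≤
      ∑ a : ZMod q, ‖expSum ZMod.stdAddChar (a • map (Int.castRingHom (ZMod q)) p)‖ := by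
  classical
  have h1 : ((q * solutionCount p q : ℕ) : ℂ) =
      ∑ a : ZMod q, expSum ZMod.stdAddChar (a • map (Int.castRingHom (ZMod q)) p) := by
    simp only [expSum, smul_eval]
    rw [Finset.sum_comm]
    have h2 : ∀ x : Fin n → ZMod q,
        ∑ a : ZMod q, ZMod.stdAddChar (a * eval x (map (Int.castRingHom (ZMod q)) p)) =
          if aeval x p = 0 then (q : ℂ) else 0 := fun x => by
      rw [AddChar.sum_mulShift _ (ZMod.isPrimitive_stdAddChar q), ← aeval_eq_eval_map, ZMod.card]
      split_ifs <;> simp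
    have h3 : solutionCount p q =
        (Finset.univ.filter fun x : Fin n → ZMod q => aeval x p = 0).card := by
      rw [solutionCount, ← Set.ncard_coe_finset]
      simp
    rw [Finset.sum_congr rfl fun x _ => h2 x, ← Finset.sum_filter, Finset.sum_const, ← h3,
      nsmul_eq_mul, mul_comm q]
    push_cast
    rfl
  have h2 : (q : ℝ) * solutionCount p q = ‖((q * solutionCount p q : ℕ) : ℂ)‖ := by
    rw [Complex.norm_natCast]
    push_cast
    rfl
  rw [h2, h1]
  exact norm_sum_le _ _

/-- There are at most `r` residue classes of order `r`, so sums over `ℤ/qℤ` of `r ^ (-1 - s)`,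
`s > 1`, are bounded. -/
lemma sum_addOrderOf_rpow_le {s : ℝ} (hs : 1 < s) (q : ℕ) [NeZero q] :
    ∑ a : ZMod q, (addOrderOf a : ℝ) ^ (-(1 + s)) ≤ ∑' r : ℕ, (r : ℝ) ^ (-s) := by
  classical
  have h1 : ∀ a ∈ (Finset.univ : Finset (ZMod q)), addOrderOf a ∈ q.divisors := fun a _ => by
    have := addOrderOf_dvd_card (x := a)
    rw [ZMod.card] at this
    exact Nat.mem_divisors.2 ⟨this, NeZero.ne q⟩
  rw [← Finset.sum_fiberwise_of_maps_to h1]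
  calc ∑ r ∈ q.divisors, ∑ a : ZMod q with addOrderOf a = r, (addOrderOf a : ℝ) ^ (-(1 + s))
      ≤ ∑ r ∈ q.divisors, (r : ℝ) ^ (-s) := by
        refine Finset.sum_le_sum fun r hr => ?_
        have hr0 : (0 : ℝ) < r := by exact_mod_cast Nat.pos_of_mem_divisors hr
        rw [Finset.sum_congr rfl (g := fun _ => (r : ℝ) ^ (-(1 + s))) fun a ha => by
          rw [(Finset.mem_filter.1 ha).2], Finset.sum_const,
          IsAddCyclic.card_addOrderOf_eq_totient
            (by rw [ZMod.card]; exact Nat.dvd_of_mem_divisors hr), nsmul_eq_mul]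
        calc (r.totient : ℝ) * (r : ℝ) ^ (-(1 + s)) ≤ r * (r : ℝ) ^ (-(1 + s)) := by
              gcongr
              exact_mod_cast Nat.totient_le r
          _ = (r : ℝ) ^ (-s) := by
              rw [← Real.rpow_one_add' hr0.le (by linarith)]
              congr 1
              ring
    _ ≤ ∑' r : ℕ, (r : ℝ) ^ (-s) :=
        (Real.summable_nat_rpow.2 (by linarith)).sum_le_tsum _ fun r _ => by positivity

end BirchCount

open BirchCount in
theorem lemma14 (n d : ℕ) (hd : 1 < d) (p : MvPolynomial (Fin n) ℤ) (hp : p.IsHomogeneous d)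
    (hB : (((d - 1) * 2 ^ d : ℕ) : ℕ∞) < birchRank p) :
    ∃ C : ℝ, ∀ q : ℕ, 1 ≤ q → (q : ℝ) ^ (1 - (n : ℤ)) * (solutionCount p q : ℝ) ≤ C := by
  obtain ⟨m, rfl⟩ : ∃ m, d = m + 1 := ⟨d - 1, by omega⟩
  have hm : 1 ≤ m := by omega
  set L := 2 ^ m * m with hL
  have hL0 : L ≠ 0 := by positivity
  have hB' : ((2 * L + 1 : ℕ) : ℕ∞) ≤ birchRank p := by
    have h1 : (m + 1 - 1) * 2 ^ (m + 1) = 2 * L := by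
      rw [hL, Nat.add_sub_cancel, pow_succ]
      ring
    rw [h1] at hB
    simpa using Order.add_one_le_of_lt hB
  obtain ⟨M, hM⟩ := exists_norm_expSum_pow_le hm hp hB'
  set s : ℝ := 1 + 1 / L with hs
  have hLpos : (0 : ℝ) < L := by exact_mod_cast Nat.pos_of_ne_zero hL0
  have hs1 : 1 < s := by
    rw [hs]
    linarith [one_div_pos.2 hLpos]
  refine ⟨(M : ℝ) ^ (1 / L : ℝ) * ∑' r : ℕ, (r : ℝ) ^ (-s), fun q hq => ?_⟩
  have : NeZero q := ⟨by omega⟩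
  have hq0 : (0 : ℝ) < q := by exact_mod_cast hq
  -- the saving `r ^ (-2 - 1 / L)` for a frequency of order `r`
  have hbound : ∀ a : ZMod q, ‖expSum ZMod.stdAddChar (a • map (Int.castRingHom (ZMod q)) p)‖ ≤
      (q : ℝ) ^ n * ((M : ℝ) ^ (1 / L : ℝ) * (addOrderOf a : ℝ) ^ (-(1 + s))) := by
    intro a
    have hr : (0 : ℝ) < addOrderOf a := by exact_mod_cast addOrderOf_pos a
    have h1 := hM q a
    set E := ‖expSum ZMod.stdAddChar (a • map (Int.castRingHom (ZMod q)) p)‖ / (q : ℝ) ^ n with hE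
    have hE0 : 0 ≤ E := by positivity
    have h2 : E ≤ (M : ℝ) ^ (1 / L : ℝ) * (addOrderOf a : ℝ) ^ (-(1 + s)) := by
      have h3 : E ^ L ≤ M * (addOrderOf a : ℝ) ^ (-((2 * L + 1 : ℕ) : ℝ)) := by
        rw [Real.rpow_neg hr.le, Real.rpow_natCast, ← div_eq_mul_inv]
        exact (le_div_iff₀ (by positivity)).2 h1
      have h4 := Real.rpow_le_rpow (by positivity) h3 (one_div_pos.2 hLpos).le
      rw [one_div, Real.pow_rpow_inv_natCast hE0 hL0, Real.mul_rpow (by positivity) (by positivity),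
        ← Real.rpow_mul hr.le] at h4
      refine h4.trans_eq ?_
      rw [one_div]
      congr 2
      rw [hs]
      push_cast
      field_simp
      ring
    rw [hE, div_le_iff₀ (by positivity)] at h2
    linarith
  have hcount : (q : ℝ) * solutionCount p q ≤
      (q : ℝ) ^ n * ((M : ℝ) ^ (1 / L : ℝ) * ∑' r : ℕ, (r : ℝ) ^ (-s)) := by
    refine (mul_solutionCount_le p q).trans ((Finset.sum_le_sum fun a _ => hbound a).trans ?_)
    rw [← Finset.mul_sum, ← Finset.mul_sum]
    gcongr
    exact sum_addOrderOf_rpow_le hs1 q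
  rw [zpow_sub₀ hq0.ne', zpow_one, zpow_natCast, div_mul_eq_mul_div]
  exact (div_le_iff₀ (by positivity)).2 (by linarith)
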